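/- Let $H$ be a complex Hilbert space with inner product $(\cdot,\cdot)$. A densely defined linear operator $A$ in $H$ is called maximal symmetric if it is symmetric and has no proper symmetric extension in $H$. A densely defined linear operator $B$ in $H$ is called maximal accretive if $\operatorname{Re}(Bu,u)\ge 0$ for all $u\in\operatorname{dom}B$ and $B$ has no proper extension in $H$ with this property. For a maximal accretive operator $B$, the square root $B^{1/2}$ is the closure of the operator $$u\mapsto \frac1\pi\int_0^\infty t^{-1/2}\,B(B+tI)^{-1}u\,dt,\qquad u\in\operatorname{dom}B,$$ and $B^{*1/2}:=(B^*)^{1/2}$. Theorem. Let $A$ be a maximal symmetric operator in $H$ that is not selfadjoint, and suppose that $i$ belongs to the resolvent set $\rho(A)$. Then the operator $B=iA$ is maximal accretive, and $$\operatorname{dom}B^{1/2}\neq\operatorname{dom}B^{*1/2}.$$ -/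

import Mathlib

noncomputable section

namespace KatoSqrt

open MeasureTheory

variable {H : Type*} [NormedAddCommGroup H] [InnerProductSpace ℂ H]

/-- `A` is symmetric: densely defined with `⟪A x, y⟫ = ⟪x, A y⟫` for all `x, y ∈ dom A`. -/
def IsSymmetric (A : H →ₗ.[ℂ] H) : Prop :=
  Dense (A.domain : Set H) ∧ A.IsFormalAdjoint A

/-- `A` is maximal symmetric: symmetric, without proper symmetric extensions in `H`. -/
def IsMaximalSymmetric (A : H →ₗ.[ℂ] H) : Prop :=
  IsSymmetric A ∧ ∀ S : H →ₗ.[ℂ] H, IsSymmetric S → A ≤ S → S = A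

/-- `B` is accretive: `Re ⟪B u, u⟫ ≥ 0` for all `u ∈ dom B`. -/
def IsAccretive (B : H →ₗ.[ℂ] H) : Prop :=
  ∀ u : B.domain, 0 ≤ (inner ℂ (B u) (u : H)).re

/-- `B` is maximal accretive: densely defined and accretive, without proper accretive
extensions in `H`. -/
def IsMaximalAccretive (B : H →ₗ.[ℂ] H) : Prop :=
  Dense (B.domain : Set H) ∧ IsAccretive B ∧
    ∀ S : H →ₗ.[ℂ] H, IsAccretive S → B ≤ S → S = B

/-- The operator `A - z I : dom A → H`. -/
def shift (A : H →ₗ.[ℂ] H) (z : ℂ) : A.domain →ₗ[ℂ] H :=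
  A.toFun - z • A.domain.subtype

open scoped Classical in
/-- The inverse `(A - z I)⁻¹ : H → dom A` (and `0` if `A - z I` is not a bijection of `dom A`
onto `H`). -/
def resolvent (A : H →ₗ.[ℂ] H) (z : ℂ) : H →ₗ[ℂ] A.domain :=
  if h : Function.Bijective (shift A z) then
    (LinearEquiv.ofBijective (shift A z) h).symm.toLinearMap
  else 0

/-- The resolvent set `ρ(A)`: the `z ∈ ℂ` for which `A - z I` is a bijection of `dom A` onto `H`
with bounded inverse. -/
def resolventSet (A : H →ₗ.[ℂ] H) : Set ℂ :=
  {z | Function.Bijective (shift A z) ∧ Continuous fun x : H => (resolvent A z x : H)}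

/-- The Balakrishnan integrand `t ^ (γ - 1) B (B + t I)⁻¹ u`. -/
def balakrishnanIntegrand (B : H →ₗ.[ℂ] H) (γ : ℝ) (u : H) (t : ℝ) : H :=
  t ^ (γ - 1) • B (resolvent B (-(t : ℂ)) u)

lemma balakrishnanIntegrand_add (B : H →ₗ.[ℂ] H) (γ : ℝ) (u v : H) :
    balakrishnanIntegrand B γ (u + v) =
      balakrishnanIntegrand B γ u + balakrishnanIntegrand B γ v := by
  funext t
  simp [balakrishnanIntegrand, LinearPMap.map_add]

lemma balakrishnanIntegrand_smul (B : H →ₗ.[ℂ] H) (γ : ℝ) (c : ℂ) (u : H) :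
    balakrishnanIntegrand B γ (c • u) = c • balakrishnanIntegrand B γ u := by
  funext t
  simp [balakrishnanIntegrand, LinearPMap.map_smul, smul_comm c]

/-- The Balakrishnan operator `u ↦ (sin (γ π) / π) ∫₀^∞ t ^ (γ - 1) B (B + t I)⁻¹ u dt` on the
vectors `u ∈ dom B` for which the integral converges absolutely. If `B` is maximal accretive and
`0 < γ < 1`, these are all the vectors of `dom B`: the integrand has norm at most
`2 t ^ (γ - 1) ‖u‖` and at most `t ^ (γ - 2) ‖B u‖`. -/
def balakrishnan (B : H →ₗ.[ℂ] H) (γ : ℝ) : H →ₗ.[ℂ] H where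
  domain :=
    { carrier := {u | u ∈ B.domain ∧ IntegrableOn (balakrishnanIntegrand B γ u) (Set.Ioi 0)}
      zero_mem' := by
        refine ⟨B.domain.zero_mem, ?_⟩
        have h : balakrishnanIntegrand B γ 0 = 0 := by
          simpa using balakrishnanIntegrand_smul B γ 0 0
        rw [h]
        exact integrableOn_zero
      add_mem' := by
        rintro u v ⟨hu, hu'⟩ ⟨hv, hv'⟩
        refine ⟨B.domain.add_mem hu hv, ?_⟩
        rw [balakrishnanIntegrand_add]
        exact hu'.add hv'
      smul_mem' := by
        rintro c u ⟨hu, hu'⟩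
        refine ⟨B.domain.smul_mem c hu, ?_⟩
        rw [balakrishnanIntegrand_smul]
        exact hu'.smul c }
  toFun :=
    { toFun := fun u =>
        (Real.sin (γ * Real.pi) / Real.pi) •
          ∫ t in Set.Ioi (0 : ℝ), balakrishnanIntegrand B γ (u : H) t
      map_add' := by
        intro u v
        rw [← smul_add, ← integral_add u.2.2 v.2.2]
        simp only [Submodule.coe_add, balakrishnanIntegrand_add, Pi.add_apply]
      map_smul' := by
        intro c u
        simp only [Submodule.coe_smul, balakrishnanIntegrand_smul, Pi.smul_apply,
          RingHom.id_apply]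
        rw [integral_smul, smul_comm] }

/-- The fractional power `B ^ γ`, `0 < γ < 1`, of a maximal accretive operator `B`: the closure
of the Balakrishnan operator on `dom B`. -/
def fracPow (B : H →ₗ.[ℂ] H) (γ : ℝ) : H →ₗ.[ℂ] H :=
  (balakrishnan B γ).closure

end KatoSqrt

end

/-!
Write `B = iA`. It is skew-symmetric, `-B ≤ B†`, hence accretive, and `-1 ∈ ρ(B)` makes it maximal
accretive. Since `A` is not selfadjoint, `A† - i` is not injective, so `B†` has an eigenvector `e`
with eigenvalue `1`; clearly `e ∈ dom B†^γ`.

On the other hand `e ∉ dom B^γ` for `1/2 ≤ γ < 1`. Solving `(B + μ) h = (1 - μ) e` produces an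
eigenvector `e + h` of `B†` for every `μ > 0`. Rescaled to `g_μ` with `‖g_μ‖ = ‖e‖`, it satisfies
`⟪g_μ, e⟫ = 2 √μ / (1 + μ) ‖e‖²`, and `⟪g_μ, v⟫ = μ⁻¹ ⟪g_μ, B v⟫` shows that `g_μ` tends weakly to
`0` as `μ → ∞`. If `B^γ e` existed, then `⟪g_μ, B^γ e⟫ = μ^γ ⟪g_μ, e⟫` would stay away from `0`.
-/

namespace KatoSqrt

open Filter MeasureTheory Set Topology
open scoped ComplexConjugate

variable {H : Type*} [NormedAddCommGroup H] [InnerProductSpace ℂ H]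

theorem inner_self_eq_ofReal_norm_sq (x : H) : inner ℂ x x = ((‖x‖ ^ 2 : ℝ) : ℂ) := by
  rw [inner_self_eq_norm_sq_to_K]
  norm_cast

section Shift

variable {A S : H →ₗ.[ℂ] H} {z w : ℂ}

theorem shift_apply (A : H →ₗ.[ℂ] H) (z : ℂ) (u : A.domain) :
    shift A z u = A u - z • (u : H) :=
  rfl

theorem shift_neg_apply (A : H →ₗ.[ℂ] H) (z : ℂ) (u : A.domain) :
    shift A (-z) u = A u + z • (u : H) := by
  rw [shift_apply, neg_smul, sub_neg_eq_add]

theorem smul_shift_apply (A : H →ₗ.[ℂ] H) (c z : ℂ) (u : A.domain) :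
    shift (c • A) (c * z) u = c • shift A z u := by
  rw [shift_apply, shift_apply, LinearPMap.smul_apply, smul_sub, mul_smul]

theorem surjective_shift_smul {c : ℂ} (hc : c ≠ 0) (hz : Function.Surjective (shift A z)) :
    Function.Surjective (shift (c • A) (c * z)) := fun v => by
  obtain ⟨u, hu⟩ := hz (c⁻¹ • v)
  exact ⟨u, by rw [smul_shift_apply, hu, smul_inv_smul₀ hc]⟩

theorem eq_of_le_of_surjective_shift (hAS : A ≤ S) (hA : Function.Surjective (shift A z))
    (hS : Function.Injective (shift S z)) : A = S := by
  refine LinearPMap.eq_of_le_of_domain_eq hAS (le_antisymm hAS.1 fun x hx => ?_)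
  obtain ⟨u, hu⟩ := hA (shift S z ⟨x, hx⟩)
  have hux : (⟨u, hAS.1 u.2⟩ : S.domain) = ⟨x, hx⟩ := hS <| by
    rw [← hu, shift_apply, shift_apply, ← hAS.2 (x := u) rfl]
  have hux' : (u : H) = x := congrArg Subtype.val hux
  exact hux' ▸ u.2

theorem shift_resolvent (hz : Function.Bijective (shift A z)) (v : H) :
    shift A z (resolvent A z v) = v := by
  rw [resolvent, dif_pos hz]
  exact (LinearEquiv.ofBijective (shift A z) hz).apply_symm_apply v

theorem resolvent_shift (hz : Function.Bijective (shift A z)) (u : A.domain) :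
    resolvent A z (shift A z u) = u :=
  hz.1 (shift_resolvent hz _)

theorem resolvent_eigenvector (hz : Function.Bijective (shift A z)) {μ : ℂ} (hμ : μ ≠ z)
    {e : A.domain} (he : A e = μ • (e : H)) : resolvent A z e = (μ - z)⁻¹ • e := by
  have hshift : shift A z e = (μ - z) • (e : H) := by rw [shift_apply, he, sub_smul]
  rw [eq_inv_smul_iff₀ (sub_ne_zero.2 hμ), ← map_smul, ← hshift, resolvent_shift hz]

/-- The resolvent `(A - z)⁻¹`, `z ∈ ρ(A)`, as a bounded operator on `H`. -/
noncomputable def resolventCLM (hz : z ∈ resolventSet A) : H →L[ℂ] H :=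
  ⟨A.domain.subtype ∘ₗ resolvent A z, hz.2⟩

theorem resolventCLM_apply (hz : z ∈ resolventSet A) (v : H) :
    resolventCLM hz v = resolvent A z v :=
  rfl

theorem surjective_shift_of_norm_smul_resolventCLM_lt_one [CompleteSpace H]
    (hz : z ∈ resolventSet A) (hw : ‖(w - z) • resolventCLM hz‖ < 1) :
    Function.Surjective (shift A w) := fun v => by
  obtain ⟨y, hy⟩ := (ContinuousLinearMap.isUnit_iff_bijective.1
    (isUnit_one_sub_of_norm_lt_one hw)).2 v
  have hshift := shift_resolvent hz.1 y
  refine ⟨resolvent A z y, ?_⟩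
  rw [shift_apply] at hshift ⊢
  calc A (resolvent A z y) - w • (resolvent A z y : H)
      = (A (resolvent A z y) - z • (resolvent A z y : H))
          - (w - z) • (resolvent A z y : H) := by module
    _ = v := by rw [hshift]; exact hy

end Shift

section Adjoint

variable [CompleteSpace H] {A B : H →ₗ.[ℂ] H} {z : ℂ}

theorem inner_shift_adjoint (hd : Dense (A.domain : Set H)) (y : A.adjoint.domain)
    (u : A.domain) :
    inner ℂ (shift A.adjoint (conj z) y) (u : H) = inner ℂ (y : H) (shift A z u) := by
  rw [shift_apply, shift_apply, inner_sub_left, inner_sub_right, inner_smul_left,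
    inner_smul_right, Complex.conj_conj, LinearPMap.adjoint_isFormalAdjoint hd y u]

theorem injective_shift_adjoint (hd : Dense (A.domain : Set H))
    (hz : Function.Surjective (shift A z)) :
    Function.Injective (shift A.adjoint (conj z)) := by
  refine (injective_iff_map_eq_zero _).2 fun y hy => ?_
  obtain ⟨u, hu⟩ := hz y
  refine Subtype.ext (inner_self_eq_zero (𝕜 := ℂ).1 ?_)
  nth_rewrite 2 [← hu]
  rw [← inner_shift_adjoint hd, hy, inner_zero_left]

theorem exists_shift_adjoint_eq (hd : Dense (A.domain : Set H)) (hz : z ∈ resolventSet A)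
    (v : H) : ∃ y : A.adjoint.domain, (y : H) = (resolventCLM hz).adjoint v ∧
      shift A.adjoint (conj z) y = v := by
  set y := (resolventCLM hz).adjoint v
  have hy (u : A.domain) : inner ℂ (v + conj z • y) (u : H) = inner ℂ y (A u) := by
    have hu : inner ℂ y (shift A z u) = inner ℂ v (u : H) := by
      rw [ContinuousLinearMap.adjoint_inner_left, resolventCLM_apply, resolvent_shift hz.1]
    rw [inner_add_left, ← hu, shift_apply, inner_sub_right, inner_smul_left, inner_smul_right,
      Complex.conj_conj, sub_add_cancel]
  have hmem : y ∈ A.adjoint.domain := LinearPMap.mem_adjoint_domain_of_exists _ ⟨_, hy⟩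
  refine ⟨⟨y, hmem⟩, rfl, ?_⟩
  rw [shift_apply, LinearPMap.adjoint_apply_eq hd ⟨y, hmem⟩ hy, add_sub_cancel_right]

theorem conj_mem_resolventSet_adjoint (hd : Dense (A.domain : Set H))
    (hz : z ∈ resolventSet A) : conj z ∈ resolventSet A.adjoint := by
  have hbij : Function.Bijective (shift A.adjoint (conj z)) :=
    ⟨injective_shift_adjoint hd hz.1.2, fun v =>
      (exists_shift_adjoint_eq hd hz v).imp fun _ h => h.2⟩
  refine ⟨hbij, (resolventCLM hz).adjoint.continuous.congr fun v => ?_⟩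
  obtain ⟨y, hyv, hy⟩ := exists_shift_adjoint_eq hd hz v
  rw [← hyv, ← hy, resolvent_shift hbij]

theorem conj_smul_adjoint_le (hd : Dense (A.domain : Set H)) (c : ℂ) :
    conj c • A.adjoint ≤ (c • A).adjoint :=
  LinearPMap.IsFormalAdjoint.le_adjoint (T := c • A) hd fun u y => by
    rw [LinearPMap.smul_apply, LinearPMap.smul_apply, inner_smul_left, inner_smul_right,
      (LinearPMap.adjoint_isFormalAdjoint hd).symm u y]

theorem exists_adjoint_smul_eigenvector (hd : Dense (A.domain : Set H)) (c : ℂ)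
    {y : A.adjoint.domain} (hy : A.adjoint y = z • (y : H)) :
    ∃ e : (c • A).adjoint.domain, (c • A).adjoint e = (conj c * z) • (e : H) ∧
      (e : H) = y := by
  have hle := conj_smul_adjoint_le hd c
  refine ⟨⟨y, hle.1 y.2⟩, ?_, rfl⟩
  rw [← hle.2 (x := y) rfl, LinearPMap.smul_apply, hy, mul_smul]

theorem IsSymmetric.exists_adjoint_eigenvector (hA : IsSymmetric A) (hsa : ¬IsSelfAdjoint A)
    (hz : Function.Surjective (shift A z)) :
    ∃ y : A.adjoint.domain, A.adjoint y = z • (y : H) ∧ (y : H) ≠ 0 := by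
  have hninj : ¬Function.Injective (shift A.adjoint z) := fun hinj => hsa <|
    LinearPMap.isSelfAdjoint_def.2
      (eq_of_le_of_surjective_shift (LinearPMap.IsFormalAdjoint.le_adjoint hA.1 hA.2) hz hinj).symm
  rw [injective_iff_map_eq_zero] at hninj
  push Not at hninj
  obtain ⟨y, hy, hy0⟩ := hninj
  exact ⟨y, sub_eq_zero.1 hy, fun h => hy0 (Subtype.ext h)⟩

theorem inner_adjoint_eigenvector (hd : Dense (B.domain : Set H)) {μ : ℂ} {g : B.adjoint.domain}
    (hg : B.adjoint g = μ • (g : H)) (v : B.domain) :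
    inner ℂ (g : H) (B v) = conj μ * inner ℂ (g : H) (v : H) := by
  rw [← LinearPMap.adjoint_isFormalAdjoint hd g v, hg, inner_smul_left]

theorem tendsto_inner_adjoint_eigenvector {ι : Type*} {l : Filter ι}
    (hd : Dense (B.domain : Set H)) {g : ι → B.adjoint.domain} {μ : ι → ℂ}
    (hg : ∀ i, B.adjoint (g i) = μ i • (g i : H)) (hμ : Tendsto (fun i => ‖μ i‖) l atTop)
    {C : NNReal} (hC : ∀ i, ‖(g i : H)‖ ≤ C) (f : H) :
    Tendsto (fun i => inner ℂ (g i : H) f) l (𝓝 0) := by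
  have hequi : Equicontinuous fun i (f : H) => inner ℂ (g i : H) f :=
    (LipschitzWith.uniformEquicontinuous _ C fun i =>
      (innerSL ℂ (g i : H)).lipschitz.weaken
        ((innerSL_apply_norm ℂ (g i : H)).trans_le (hC i))).equicontinuous
  refine (hequi.isClosed_setOfPred_tendsto (l := l) (f := fun _ => 0)
    continuous_const).closure_subset_iff.2 (fun v hv => ?_) (hd f)
  have hbound (i : ι) : ‖μ i‖ * ‖inner ℂ (g i : H) v‖ ≤ C * ‖B ⟨v, hv⟩‖ :=
    calc ‖μ i‖ * ‖inner ℂ (g i : H) v‖ = ‖inner ℂ (g i : H) (B ⟨v, hv⟩)‖ := by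
          rw [inner_adjoint_eigenvector hd (hg i), norm_mul, RCLike.norm_conj]
      _ ≤ ‖(g i : H)‖ * ‖B ⟨v, hv⟩‖ := norm_inner_le_norm _ _
      _ ≤ C * ‖B ⟨v, hv⟩‖ := by gcongr; exact hC i
  refine squeeze_zero_norm' ?_ (tendsto_const_nhds.div_atTop hμ : Tendsto
    (fun i => C * ‖B ⟨v, hv⟩‖ / ‖μ i‖) l (𝓝 0))
  filter_upwards [hμ.eventually_gt_atTop 0] with i hi
  rw [le_div_iff₀' hi]
  exact hbound i

end Adjoint

section Accretive

variable {B : H →ₗ.[ℂ] H} {s t : ℝ}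

theorem re_inner_shift_neg (B : H →ₗ.[ℂ] H) (t : ℝ) (u : B.domain) :
    (inner ℂ (shift B (-(t : ℂ)) u) (u : H)).re =
      (inner ℂ (B u) (u : H)).re + t * ‖(u : H)‖ ^ 2 := by
  rw [shift_neg_apply, inner_add_left, inner_smul_left, Complex.conj_ofReal, Complex.add_re,
    Complex.re_ofReal_mul, inner_self_eq_ofReal_norm_sq, Complex.ofReal_re]

theorem IsAccretive.mul_norm_le_norm_shift (hB : IsAccretive B) (t : ℝ) (u : B.domain) :
    t * ‖(u : H)‖ ≤ ‖shift B (-(t : ℂ)) u‖ := by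
  have hre : t * ‖(u : H)‖ ^ 2 ≤ ‖shift B (-(t : ℂ)) u‖ * ‖(u : H)‖ :=
    calc t * ‖(u : H)‖ ^ 2
        ≤ (inner ℂ (B u) (u : H)).re + t * ‖(u : H)‖ ^ 2 := le_add_of_nonneg_left (hB u)
      _ = (inner ℂ (shift B (-(t : ℂ)) u) (u : H)).re := (re_inner_shift_neg B t u).symm
      _ ≤ ‖shift B (-(t : ℂ)) u‖ * ‖(u : H)‖ :=
        (Complex.re_le_norm _).trans (norm_inner_le_norm _ _)
  rcases (norm_nonneg (u : H)).eq_or_lt with hu | hu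
  · rw [← hu, mul_zero]
    exact norm_nonneg _
  · exact le_of_mul_le_mul_right (by linarith) hu

theorem IsAccretive.injective_shift (hB : IsAccretive B) (ht : 0 < t) :
    Function.Injective (shift B (-(t : ℂ))) := by
  refine (injective_iff_map_eq_zero _).2 fun u hu => Subtype.ext (norm_le_zero_iff.1 ?_)
  have h := hB.mul_norm_le_norm_shift t u
  rw [hu, norm_zero] at h
  exact nonpos_of_mul_nonpos_right h ht

theorem IsAccretive.isMaximalAccretive (hB : IsAccretive B) (hd : Dense (B.domain : Set H))
    (ht : 0 < t) (hsurj : Function.Surjective (shift B (-(t : ℂ)))) : IsMaximalAccretive B :=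
  ⟨hd, hB, fun _ hS hBS =>
    (eq_of_le_of_surjective_shift hBS hsurj (hS.injective_shift ht)).symm⟩

theorem IsAccretive.norm_resolvent_le (hB : IsAccretive B) (ht : 0 < t)
    (hbij : Function.Bijective (shift B (-(t : ℂ)))) (v : H) :
    ‖(resolvent B (-(t : ℂ)) v : H)‖ ≤ t⁻¹ * ‖v‖ := by
  have h := hB.mul_norm_le_norm_shift t (resolvent B (-(t : ℂ)) v)
  rwa [shift_resolvent hbij, ← le_inv_mul_iff₀ ht] at h

theorem IsAccretive.neg_mem_resolventSet (hB : IsAccretive B) (ht : 0 < t)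
    (hsurj : Function.Surjective (shift B (-(t : ℂ)))) : -(t : ℂ) ∈ resolventSet B := by
  have hbij := And.intro (hB.injective_shift ht) hsurj
  exact ⟨hbij, (LinearMap.mkContinuous (B.domain.subtype ∘ₗ resolvent B (-(t : ℂ))) t⁻¹
    (hB.norm_resolvent_le ht hbij)).continuous⟩

theorem IsAccretive.surjective_shift_of_lt_two_mul [CompleteSpace H] (hB : IsAccretive B)
    (hs : 0 < s) (hsurj : Function.Surjective (shift B (-(s : ℂ)))) (ht : 0 < t)
    (hts : t < 2 * s) : Function.Surjective (shift B (-(t : ℂ))) := by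
  have hmem := hB.neg_mem_resolventSet hs hsurj
  have hnorm : ‖resolventCLM hmem‖ ≤ s⁻¹ :=
    ContinuousLinearMap.opNorm_le_bound _ (by positivity) (hB.norm_resolvent_le hs hmem.1)
  have hst : |s - t| < s := abs_lt.2 ⟨by linarith, by linarith⟩
  refine surjective_shift_of_norm_smul_resolventCLM_lt_one hmem ?_
  calc ‖(-(t : ℂ) - -(s : ℂ)) • resolventCLM hmem‖ = |s - t| * ‖resolventCLM hmem‖ := by
        rw [norm_smul, neg_sub_neg, ← Complex.ofReal_sub, Complex.norm_real, Real.norm_eq_abs]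
    _ ≤ |s - t| * s⁻¹ := by gcongr
    _ < 1 := by rwa [← div_eq_mul_inv, div_lt_one hs]

theorem IsAccretive.surjective_shift [CompleteSpace H] (hB : IsAccretive B) (hs : 0 < s)
    (hsurj : Function.Surjective (shift B (-(s : ℂ)))) (ht : 0 < t) :
    Function.Surjective (shift B (-(t : ℂ))) := by
  have hpow (n : ℕ) : Function.Surjective (shift B (-(((3 / 2 : ℝ) ^ n * s : ℝ) : ℂ))) := by
    induction n with
    | zero => simpa only [pow_zero, one_mul] using hsurj
    | succ n ih =>
      refine hB.surjective_shift_of_lt_two_mul (by positivity) ih (by positivity) ?_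
      rw [pow_succ]
      nlinarith [show 0 < (3 / 2 : ℝ) ^ n * s by positivity]
  obtain ⟨n, hn⟩ := pow_unbounded_of_one_lt (t / s) (show (1 : ℝ) < 3 / 2 by norm_num)
  rw [div_lt_iff₀ hs] at hn
  exact hB.surjective_shift_of_lt_two_mul (by positivity) (hpow n) ht (by linarith)

end Accretive

section FracPow

variable {B : H →ₗ.[ℂ] H} {γ μ : ℝ}

/-- The constant `c γ` such that `balakrishnan B γ` acts on eigenvectors of eigenvalue `μ ≥ 0` as
multiplication by `c γ * μ ^ γ`. By Euler's reflection formula it equals `1`; the argument only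
uses that it is positive. -/
noncomputable def balakrishnanConst (γ : ℝ) : ℝ :=
  Real.sin (γ * Real.pi) / Real.pi * ∫ t in Ioi (0 : ℝ), Real.rpowIntegrand₀₁ γ t 1

theorem balakrishnanConst_pos (hγ : γ ∈ Ioo 0 1) : 0 < balakrishnanConst γ := by
  have hsin : 0 < Real.sin (γ * Real.pi) :=
    Real.sin_pos_of_pos_of_lt_pi (mul_pos hγ.1 Real.pi_pos)
      (mul_lt_of_lt_one_left Real.pi_pos hγ.2)
  exact mul_pos (div_pos hsin Real.pi_pos) (Real.integral_rpowIntegrand₀₁_one_pos hγ)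

theorem sin_div_pi_mul_integral_rpowIntegrand₀₁ (hγ : γ ∈ Ioo 0 1) (hμ : 0 ≤ μ) :
    Real.sin (γ * Real.pi) / Real.pi * ∫ t in Ioi (0 : ℝ), Real.rpowIntegrand₀₁ γ t μ =
      balakrishnanConst γ * μ ^ γ := by
  rw [Real.integral_rpowIntegrand₀₁_eq_rpow_mul_const hγ hμ, balakrishnanConst]
  ring

theorem mem_domain_fracPow_of_eigenvector (hγ : γ ∈ Ioo 0 1) (hμ : 0 ≤ μ)
    (hB : ∀ t : ℝ, 0 < t → Function.Bijective (shift B (-(t : ℂ)))) {e : B.domain}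
    (he : B e = (μ : ℂ) • (e : H)) : (e : H) ∈ (fracPow B γ).domain := by
  refine (LinearPMap.le_closure (balakrishnan B γ)).1 ⟨e.2, ?_⟩
  have hint : IntegrableOn (fun t => Real.rpowIntegrand₀₁ γ t μ • (e : H)) (Ioi 0) :=
    (Real.integrableOn_rpowIntegrand₀₁_Ioi hγ hμ).smul_const (e : H)
  refine hint.congr_fun (fun t (ht : 0 < t) => ?_) measurableSet_Ioi
  have hne : (μ : ℂ) ≠ -t := by
    rw [ne_eq, eq_neg_iff_add_eq_zero]
    exact_mod_cast (add_pos_of_nonneg_of_pos hμ ht).ne'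
  beta_reduce
  rw [balakrishnanIntegrand, resolvent_eigenvector (hB t ht) hne he, LinearPMap.map_smul, he,
    Real.rpowIntegrand₀₁_eq_pow_div hγ ht.le hμ, ← Complex.coe_smul, ← Complex.coe_smul,
    smul_smul, smul_smul]
  congr 1
  push_cast
  ring

theorem graph_closure_le (T : H →ₗ.[ℂ] H) : T.closure.graph ≤ T.graph.topologicalClosure := by
  by_cases hT : T.IsClosable
  · exact hT.graph_closure_eq_closure_graph.ge
  · rw [LinearPMap.closure_def' hT]
    exact T.graph.le_topologicalClosure

variable [CompleteSpace H] {g : B.adjoint.domain}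

theorem inner_balakrishnanIntegrand (hγ : γ ∈ Ioo 0 1) (hμ : 0 ≤ μ)
    (hd : Dense (B.domain : Set H)) (hg : B.adjoint g = (μ : ℂ) • (g : H)) {t : ℝ} (ht : 0 < t)
    (hB : Function.Bijective (shift B (-(t : ℂ)))) (u : H) :
    inner ℂ (g : H) (balakrishnanIntegrand B γ u t) =
      (Real.rpowIntegrand₀₁ γ t μ : ℂ) * inner ℂ (g : H) u := by
  set w := resolvent B (-(t : ℂ)) u with hw
  have hne : (t : ℂ) + μ ≠ 0 := by exact_mod_cast (add_pos_of_pos_of_nonneg ht hμ).ne'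
  have hBw : inner ℂ (g : H) (B w) = μ * inner ℂ (g : H) (w : H) := by
    rw [inner_adjoint_eigenvector hd hg, Complex.conj_ofReal]
  have hu : inner ℂ (g : H) u = (t + μ) * inner ℂ (g : H) (w : H) := by
    rw [← shift_resolvent hB u, shift_neg_apply, ← hw, inner_add_right, inner_smul_right, hBw]
    ring
  rw [balakrishnanIntegrand, ← hw, ← Complex.coe_smul, inner_smul_right, hBw, hu,
    Real.rpowIntegrand₀₁_eq_pow_div hγ ht.le hμ]
  push_cast
  field_simp

theorem inner_balakrishnan (hγ : γ ∈ Ioo 0 1) (hμ : 0 ≤ μ) (hd : Dense (B.domain : Set H))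
    (hB : ∀ t : ℝ, 0 < t → Function.Bijective (shift B (-(t : ℂ))))
    (hg : B.adjoint g = (μ : ℂ) • (g : H)) (u : (balakrishnan B γ).domain) :
    inner ℂ (g : H) (balakrishnan B γ u) =
      ((balakrishnanConst γ * μ ^ γ : ℝ) : ℂ) * inner ℂ (g : H) (u : H) := by
  have hint : inner ℂ (g : H) (∫ t in Ioi (0 : ℝ), balakrishnanIntegrand B γ (u : H) t) =
      ((∫ t in Ioi (0 : ℝ), Real.rpowIntegrand₀₁ γ t μ : ℝ) : ℂ) * inner ℂ (g : H) (u : H) := by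
    rw [← integral_inner u.2.2, setIntegral_congr_fun measurableSet_Ioi fun t ht =>
      inner_balakrishnanIntegrand hγ hμ hd hg ht (hB t ht) u, integral_mul_const,
      integral_complex_ofReal]
  change inner ℂ (g : H) ((Real.sin (γ * Real.pi) / Real.pi) •
    ∫ t in Ioi (0 : ℝ), balakrishnanIntegrand B γ (u : H) t) = _
  rw [← Complex.coe_smul, inner_smul_right, hint, ← mul_assoc, ← Complex.ofReal_mul,
    sin_div_pi_mul_integral_rpowIntegrand₀₁ hγ hμ]

theorem inner_fracPow (hγ : γ ∈ Ioo 0 1) (hμ : 0 ≤ μ) (hd : Dense (B.domain : Set H))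
    (hB : ∀ t : ℝ, 0 < t → Function.Bijective (shift B (-(t : ℂ))))
    (hg : B.adjoint g = (μ : ℂ) • (g : H)) (u : (fracPow B γ).domain) :
    inner ℂ (g : H) (fracPow B γ u) =
      ((balakrishnanConst γ * μ ^ γ : ℝ) : ℂ) * inner ℂ (g : H) (u : H) := by
  have hclosed : IsClosed {p : H × H | inner ℂ (g : H) p.2 =
      ((balakrishnanConst γ * μ ^ γ : ℝ) : ℂ) * inner ℂ (g : H) p.1} :=
    isClosed_eq (by fun_prop) (by fun_prop)
  refine closure_minimal (fun p hp => ?_) hclosed (graph_closure_le _ (LinearPMap.mem_graph _ u))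
  obtain ⟨v, hv, hBv⟩ := (LinearPMap.mem_graph_iff _).1 hp
  rw [mem_ofPred_eq, ← hv, ← hBv]
  exact inner_balakrishnan hγ hμ hd hB hg v

end FracPow

section SkewSymmetric

/-- `B` is skew-symmetric: densely defined with `⟪B x, y⟫ = -⟪x, B y⟫` for all `x, y ∈ dom B`.
These are the operators `i A` with `A` symmetric. -/
def IsSkewSymmetric (B : H →ₗ.[ℂ] H) : Prop :=
  Dense (B.domain : Set H) ∧ B.IsFormalAdjoint (-B)

variable {A B : H →ₗ.[ℂ] H} {γ ν μ : ℝ}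

theorem IsSymmetric.isSkewSymmetric_I_smul (hA : IsSymmetric A) :
    IsSkewSymmetric (Complex.I • A) :=
  ⟨hA.1, fun u v => by
    rw [LinearPMap.neg_apply, LinearPMap.smul_apply, LinearPMap.smul_apply, inner_neg_right,
      inner_smul_left, inner_smul_right, Complex.conj_I, hA.2 u v, neg_mul]⟩

theorem IsSkewSymmetric.re_inner_eq_zero (hB : IsSkewSymmetric B) (u : B.domain) :
    (inner ℂ (B u) (u : H)).re = 0 := by
  have h := congrArg Complex.re (hB.2 u u)
  rw [LinearPMap.neg_apply, inner_neg_right, Complex.neg_re, ← inner_conj_symm (u : H),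
    Complex.conj_re] at h
  linarith

theorem IsSkewSymmetric.isAccretive (hB : IsSkewSymmetric B) : IsAccretive B :=
  fun u => (hB.re_inner_eq_zero u).ge

variable [CompleteSpace H]

theorem inner_of_shift_eq_smul (hd : Dense (B.domain : Set H)) (hνμ : ν + μ ≠ 0)
    {e : B.adjoint.domain} (he : B.adjoint e = (ν : ℂ) • (e : H)) {h : B.domain} {c : ℝ}
    (hh : shift B (-(μ : ℂ)) h = (c : ℂ) • (e : H)) :
    inner ℂ (e : H) (h : H) = ((c / (ν + μ) * ‖(e : H)‖ ^ 2 : ℝ) : ℂ) := by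
  have hne : (ν : ℂ) + μ ≠ 0 := by exact_mod_cast hνμ
  have hinner := congrArg (inner ℂ (e : H)) hh
  rw [shift_neg_apply, inner_add_right, inner_smul_right, inner_smul_right,
    inner_adjoint_eigenvector hd he, Complex.conj_ofReal, inner_self_eq_ofReal_norm_sq,
    ← add_mul] at hinner
  refine mul_left_cancel₀ hne (hinner.trans ?_)
  push_cast
  field_simp

theorem IsSkewSymmetric.exists_adjoint_eigenvector (hB : IsSkewSymmetric B) (hνμ : ν + μ ≠ 0)
    (hsurj : Function.Surjective (shift B (-(μ : ℂ)))) {e : B.adjoint.domain}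
    (he : B.adjoint e = (ν : ℂ) • (e : H)) :
    ∃ g : B.adjoint.domain, B.adjoint g = (μ : ℂ) • (g : H) ∧
      inner ℂ (e : H) (g : H) = ((2 * ν / (ν + μ) * ‖(e : H)‖ ^ 2 : ℝ) : ℂ) ∧
      μ * ‖(g : H)‖ ^ 2 = ν * ‖(e : H)‖ ^ 2 := by
  obtain ⟨h, hh⟩ := hsurj (((ν - μ : ℝ) : ℂ) • (e : H))
  have heh := inner_of_shift_eq_smul hB.1 hνμ he hh
  have hle : -B ≤ B.adjoint := LinearPMap.IsFormalAdjoint.le_adjoint hB.1 hB.2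
  let h' : B.adjoint.domain := ⟨h, hle.1 h.2⟩
  have hBh' : B.adjoint h' = -B h := (hle.2 (x := h) rfl).symm
  refine ⟨e + h', ?_, ?_, ?_⟩
  · have hBh := eq_sub_of_add_eq ((shift_neg_apply B μ h).symm.trans hh)
    rw [LinearPMap.map_add, he, hBh', hBh, Submodule.coe_add]
    push_cast
    module
  · rw [Submodule.coe_add, inner_add_right, heh, inner_self_eq_ofReal_norm_sq,
      ← Complex.ofReal_add]
    congr 1
    field_simp
    ring
  · have hnorm : μ * ‖(h : H)‖ ^ 2 = (ν - μ) * ((ν - μ) / (ν + μ) * ‖(e : H)‖ ^ 2) := by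
      have hre := re_inner_shift_neg B μ h
      rwa [hB.re_inner_eq_zero, zero_add, hh, inner_smul_left, Complex.conj_ofReal, heh,
        ← Complex.ofReal_mul, Complex.ofReal_re, eq_comm] at hre
    rw [Submodule.coe_add, norm_add_sq (𝕜 := ℂ), heh, RCLike.re_eq_complex_re, Complex.ofReal_re,
      mul_add, mul_add, hnorm]
    field_simp
    ring

theorem IsSkewSymmetric.exists_adjoint_eigenvector_norm_eq (hB : IsSkewSymmetric B) (hν : 0 < ν)
    (hμ : 0 < μ) (hsurj : Function.Surjective (shift B (-(μ : ℂ)))) {e : B.adjoint.domain}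
    (he : B.adjoint e = (ν : ℂ) • (e : H)) :
    ∃ g : B.adjoint.domain, B.adjoint g = (μ : ℂ) • (g : H) ∧ ‖(g : H)‖ = ‖(e : H)‖ ∧
      inner ℂ (e : H) (g : H) = ((2 * √(ν * μ) / (ν + μ) * ‖(e : H)‖ ^ 2 : ℝ) : ℂ) := by
  obtain ⟨g, hg, hge, hnorm⟩ := hB.exists_adjoint_eigenvector (add_pos hν hμ).ne' hsurj he
  refine ⟨((√(μ / ν) : ℝ) : ℂ) • g, ?_, ?_, ?_⟩
  · rw [LinearPMap.map_smul, hg, Submodule.coe_smul, smul_comm]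
  · rw [Submodule.coe_smul, norm_smul, Complex.norm_real, Real.norm_of_nonneg (Real.sqrt_nonneg _),
      ← sq_eq_sq₀ (by positivity) (norm_nonneg _), mul_pow, Real.sq_sqrt (by positivity),
      div_mul_eq_mul_div, hnorm, mul_div_cancel_left₀ _ hν.ne']
  · have hsqrt : √(μ / ν) * ν = √(ν * μ) := by
      rw [Real.sqrt_mul hν.le, Real.sqrt_div' μ hν.le, div_mul_eq_mul_div, mul_div_assoc,
        Real.div_sqrt, mul_comm]
    rw [Submodule.coe_smul, inner_smul_right, hge, ← Complex.ofReal_mul, ← hsqrt]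
    congr 1
    ring

theorem sqrt_le_rpow_mul_sqrt_mul_div (hγ : 1 / 2 ≤ γ) (hν : 0 < ν) (hμ : 1 ≤ μ) (hνμ : ν ≤ μ) :
    √ν ≤ μ ^ γ * (2 * √(ν * μ) / (ν + μ)) := by
  have hμ0 : 0 < μ := by linarith
  calc √ν ≤ √ν * (2 * μ / (ν + μ)) := by
        refine le_mul_of_one_le_right (Real.sqrt_nonneg ν) ?_
        rw [one_le_div (by positivity)]
        linarith
    _ = √μ * (2 * √(ν * μ) / (ν + μ)) := by
        rw [Real.sqrt_mul hν.le]
        nth_rewrite 1 [← Real.mul_self_sqrt hμ0.le]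
        ring
    _ ≤ μ ^ γ * (2 * √(ν * μ) / (ν + μ)) := by
        gcongr
        rw [Real.sqrt_eq_rpow]
        exact Real.rpow_le_rpow_of_exponent_le hμ hγ

theorem IsSkewSymmetric.notMem_domain_fracPow (hB : IsSkewSymmetric B)
    (hbij : ∀ t : ℝ, 0 < t → Function.Bijective (shift B (-(t : ℂ)))) (hγ : γ ∈ Ico (1 / 2) 1)
    (hν : 0 < ν) {e : B.adjoint.domain} (he : B.adjoint e = (ν : ℂ) • (e : H))
    (hne : (e : H) ≠ 0) : (e : H) ∉ (fracPow B γ).domain := by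
  intro hmem
  have hγ' : γ ∈ Ioo 0 1 := ⟨one_half_pos.trans_le hγ.1, hγ.2⟩
  have hc := balakrishnanConst_pos hγ'
  let μ : ℕ → ℝ := fun n => n + 1
  have hμ_pos (n : ℕ) : 0 < μ n := n.cast_add_one_pos
  have hμ : Tendsto μ atTop atTop := tendsto_atTop_add_const_right _ _ tendsto_natCast_atTop_atTop
  choose g hg hgnorm hge using fun n =>
    hB.exists_adjoint_eigenvector_norm_eq hν (hμ_pos n) (hbij _ (hμ_pos n)).2 he
  have hμ_norm : Tendsto (fun n => ‖(μ n : ℂ)‖) atTop atTop := by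
    simpa only [Complex.norm_real, Function.comp_def] using tendsto_norm_atTop_atTop.comp hμ
  have hweak : Tendsto (fun n => ‖inner ℂ (g n : H) (fracPow B γ ⟨e, hmem⟩)‖) atTop (𝓝 0) :=
    tendsto_zero_iff_norm_tendsto_zero.1 <| tendsto_inner_adjoint_eigenvector hB.1 hg hμ_norm
      (C := ‖(e : H)‖₊) (fun n => (hgnorm n).le) _
  refine (show 0 < balakrishnanConst γ * √ν * ‖(e : H)‖ ^ 2 by positivity).not_ge
    (ge_of_tendsto hweak ?_)
  filter_upwards [hμ.eventually_ge_atTop ν] with n hn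
  have hbound := sqrt_le_rpow_mul_sqrt_mul_div hγ.1 hν (le_add_of_nonneg_left n.cast_nonneg) hn
  rw [inner_fracPow hγ' (hμ_pos n).le hB.1 hbij (hg n) ⟨e, hmem⟩, norm_mul,
    norm_inner_symm, hge, ← norm_mul, ← Complex.ofReal_mul, Complex.norm_real,
    Real.norm_of_nonneg (by positivity)]
  calc balakrishnanConst γ * √ν * ‖(e : H)‖ ^ 2
      ≤ balakrishnanConst γ * (μ n ^ γ * (2 * √(ν * μ n) / (ν + μ n))) * ‖(e : H)‖ ^ 2 := by gcongr
    _ = _ := by ring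

end SkewSymmetric

end KatoSqrt

open KatoSqrt in
theorem mainTheorem2_general {H : Type*} [NormedAddCommGroup H] [InnerProductSpace ℂ H]
    [CompleteSpace H] (A : H →ₗ.[ℂ] H) (hA : IsSymmetric A) (hsa : ¬IsSelfAdjoint A)
    (hsurj : Function.Surjective (shift A Complex.I)) :
    IsMaximalAccretive (Complex.I • A) ∧ ∀ γ ∈ Set.Ico (1 / 2 : ℝ) 1,
      (fracPow (Complex.I • A) γ).domain ≠ (fracPow (Complex.I • A).adjoint γ).domain := by
  have hskew := hA.isSkewSymmetric_I_smul
  have hone : Function.Surjective (shift (Complex.I • A) (-((1 : ℝ) : ℂ))) := by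
    simpa only [Complex.I_mul_I, Complex.ofReal_one] using
      surjective_shift_smul Complex.I_ne_zero hsurj
  have hres (t : ℝ) (ht : 0 < t) : -(t : ℂ) ∈ resolventSet (Complex.I • A) :=
    hskew.isAccretive.neg_mem_resolventSet ht
      (hskew.isAccretive.surjective_shift one_pos hone ht)
  have hres_adjoint (t : ℝ) (ht : 0 < t) : -(t : ℂ) ∈ resolventSet (Complex.I • A).adjoint := by
    simpa only [map_neg, Complex.conj_ofReal] using
      conj_mem_resolventSet_adjoint hskew.1 (hres t ht)
  obtain ⟨y, hy, hy0⟩ := hA.exists_adjoint_eigenvector hsa hsurj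
  obtain ⟨e, he, hey⟩ := exists_adjoint_smul_eigenvector hA.1 Complex.I hy
  rw [Complex.conj_I, neg_mul, Complex.I_mul_I, neg_neg, ← Complex.ofReal_one] at he
  refine ⟨hskew.isAccretive.isMaximalAccretive hskew.1 one_pos hone, fun γ hγ heq => ?_⟩
  refine hskew.notMem_domain_fracPow (fun t ht => (hres t ht).1) hγ one_pos he (hey ▸ hy0) ?_
  rw [heq]
  exact mem_domain_fracPow_of_eigenvector ⟨one_half_pos.trans_le hγ.1, hγ.2⟩ zero_le_one
    (fun t ht => (hres_adjoint t ht).1) he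

theorem mainTheorem2 {H : Type*} [NormedAddCommGroup H] [InnerProductSpace ℂ H]
    [CompleteSpace H] (A : H →ₗ.[ℂ] H)
    (hmax : KatoSqrt.IsMaximalSymmetric A) (hsa : ¬ IsSelfAdjoint A)
    (hres : Complex.I ∈ KatoSqrt.resolventSet A) :
    KatoSqrt.IsMaximalAccretive (Complex.I • A) ∧
      (KatoSqrt.fracPow (Complex.I • A) (1 / 2)).domain ≠
        (KatoSqrt.fracPow (Complex.I • A).adjoint (1 / 2)).domain :=
  have ⟨hacc, hdom⟩ := mainTheorem2_general A hmax.1 hsa hres.1.2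
  ⟨hacc, hdom _ (Set.left_mem_Ico.2 one_half_lt_one)⟩
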